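/- Consider $N$ links sharing a channel in slotted time $t=0,1,2,\dots$. The channel states $s(t)=(h(t),g(t),I(t))\in\mathbb{R}_{\ge 0}^{3N}$ (direct gains, interference gains, external interference levels) are i.i.d. over time. All links transmit with constant power $P>0$. The service rates $R_i(t)=R_i(s(t))\ge 0$ satisfy $\mathbb{E}[R_i(t)^2]\le R_{\max}^2<\infty$. There is an average interference threshold $\gamma>0$, an instantaneous interference threshold $\nu$, and an input limit $A_{\max}>0$. Each utility $U_i:[0,\infty)\to\mathbb{R}$ is continuously differentiable, nondecreasing and concave with $U_i(0)=0$. Let the stability region $\Lambda$ be the set of all $x\in\mathbb{R}_{\ge0}^N$ for which there is a (measurable) scheduling policy $p:\mathbb{R}_{\ge0}^{3N}\to[0,1]^N$ with $\sum_i p_i\le 1$, with $p_i=0$ whenever $Pg_i>\nu$, with $\sum_i\mathbb{E}[P g_i p_i]\le\gamma$, and with $\mathbb{E}[p_iR_i]\ge x_i$ for all $i$. Let $U^*$ be the supremum of $\sum_i U_i(x_i)$ over all $x\in\Lambda$ with $x_i\le A_{\max}$ for all $i$. The control algorithm with parameter $V>0$ starts from backlogs $Q_i(0)=q_i\ge0$,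 $Z(0)=z\ge 0$ and works as follows in each slot $t$. (1) Flow control: $A_i(t)$ is a maximizer of $V U_i(x)-Q_i(t)x$ over $0\le x\le A_{\max}$. (2) Scheduling: let $W_i(t)=Q_i(t)R_i(t)-P Z(t) g_i(t)$ and $C=\{j: W_j(t)\ge 0,\ Pg_j(t)\le\nu\}$. If $C=\emptyset$, no link is scheduled; otherwise exactly one link $i\in\arg\max_{j\in C}W_j(t)$ is scheduled. Write $\mathcal{I}_i(t)=1$ if link $i$ is scheduled, and $\mathcal{I}_i(t)=0$ otherwise. Ties in (1) and (2) are broken in any way that does not anticipate future channel states. (3) The queues are updated by $Q_i(t+1)=[Q_i(t)-\mathcal{I}_i(t)R_i(t)]^+ + A_i(t)$ and $Z(t+1)=[Z(t)-\gamma+\sum_i\mathcal{I}_i(t)Pg_i(t)]^+$. Then there are constants $B_1,\epsilon_1,\kappa>0$, depending only on the network (the law of the channel states and the above parameters and functions) and on the initial backlogs, but not on $V$, such that for every $V>0$ the following holds. The average arrival rates $x_i^*=\limsup_{T\to\infty}\frac1T\sum_{t=1}^T A_i(t)$ produced by the algorithm satisfy, almost surely, $$\sum_{i=1}^N U_i(x_i^*)\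 \ge\ U^*-\frac{B_1}{V},$$ and $$\limsup_{T\to\infty}\frac1T\sum_{\tau=0}^{T-1}\sum_{i=1}^N\mathbb{E}[Q_i(\tau)]\ \le\ \frac{B_1+V\kappa}{\epsilon_1}.$$ -/

import Mathlib

open MeasureTheory ProbabilityTheory Filter
open scoped NNReal ENNReal

namespace EdgeControl

/-- Joint channel state `(h, g, I)` of one slot: direct gains, interference gains towards the core
access point, and interference levels received from outside the edge network. -/
abbrev ChannelState (N : ℕ) : Type :=
  (Fin N → ℝ≥0) × (Fin N → ℝ≥0) × (Fin N → ℝ≥0)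

/-- Interference gain `g i` of link `i` in the channel state `s`. -/
def interferenceGain {N : ℕ} (s : ChannelState N) (i : Fin N) : ℝ := (s.2.1 i : ℝ)

/-- The data of an edge network with `N` links, with its standing model assumptions. -/
structure EdgeNetwork (N : ℕ) where
  /-- common law of the channel states of the slots -/
  law : Measure (ChannelState N)
  isProb : IsProbabilityMeasure law
  /-- constant transmission power `P` -/
  power : ℝ
  power_pos : 0 < power
  /-- average interference threshold `γ` -/
  gamma : ℝ
  gamma_pos : 0 < gamma
  /-- instantaneous interference threshold `ν` -/
  nu : ℝ
  /-- maximal admissible input `A_max` per slot -/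
  aMax : ℝ
  aMax_pos : 0 < aMax
  /-- service rates `R i` (at the constant power `P`) as functions of the channel state -/
  rate : Fin N → ChannelState N → ℝ
  rate_measurable : ∀ i, Measurable (rate i)
  rate_nonneg : ∀ i s, 0 ≤ rate i s
  /-- bound `R_max` for the root mean square of the rates -/
  rMax : ℝ
  rate_sq_integrable : ∀ i, Integrable (fun s => rate i s ^ 2) law
  rate_sq_le : ∀ i, ∫ s, rate i s ^ 2 ∂law ≤ rMax ^ 2
  /-- utility functions `U i`, used on `[0, ∞)` only -/
  utility : Fin N → ℝ → ℝ
  utility_zero : ∀ i, utility i 0 = 0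
  utility_contDiff : ∀ i, ContDiffOn ℝ 1 (utility i) (Set.Ici 0)
  utility_mono : ∀ i, MonotoneOn (utility i) (Set.Ici 0)
  utility_concave : ∀ i, ConcaveOn ℝ (Set.Ici 0) (utility i)

namespace EdgeNetwork

variable {N : ℕ} (net : EdgeNetwork N)

/-- A (randomized) scheduling policy: scheduling probabilities as a function of the channel
state, with total mass at most one. -/
structure IsSchedulingPolicy (p : ChannelState N → Fin N → ℝ) : Prop where
  measurable : ∀ i, Measurable (fun s => p s i)
  mem_Icc : ∀ s i, p s i ∈ Set.Icc (0 : ℝ) 1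
  sum_le_one : ∀ s, ∑ i, p s i ≤ 1

/-- The policy respects the average and the instantaneous interference thresholds. -/
structure IsInterferenceAware (p : ChannelState N → Fin N → ℝ) : Prop where
  average_le : ∑ i, ∫ s, net.power * interferenceGain s i * p s i ∂net.law ≤ net.gamma
  instantaneous : ∀ s i, net.nu < net.power * interferenceGain s i → p s i = 0

/-- The network stability region `Λ`. -/
def stabilityRegion : Set (Fin N → ℝ) :=
  {x | (∀ i, 0 ≤ x i) ∧
    ∃ p : ChannelState N → Fin N → ℝ, IsSchedulingPolicy p ∧ net.IsInterferenceAware p ∧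
      ∀ i, x i ≤ ∫ s, p s i * net.rate i s ∂net.law}

/-- The optimal aggregate utility `U*`: the supremum of `∑ i, U i (x i)` over the arrival rate
vectors `x` of `Λ`. An arrival rate is a long-term average of admissible inputs, so it is at most
`A_max`. -/
noncomputable def optimalUtility : ℝ :=
  sSup ((fun x : Fin N → ℝ => ∑ i, net.utility i (x i)) ''
    {x | x ∈ net.stabilityRegion ∧ ∀ i, x i ≤ net.aMax})

/-- The weight `W i = Q i * R i - P * Z * g i` of link `i`. -/
def weight (q : Fin N → ℝ) (z : ℝ) (s : ChannelState N) (i : Fin N) : ℝ :=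
  q i * net.rate i s - net.power * z * interferenceGain s i

/-- The candidate set `C` of links with nonnegative weight that satisfy the instantaneous
interference constraint. -/
def candidates (q : Fin N → ℝ) (z : ℝ) (s : ChannelState N) : Set (Fin N) :=
  {j | 0 ≤ net.weight q z s j ∧ net.power * interferenceGain s j ≤ net.nu}

/-- `a` is a flow control decision at backlog `q`: a maximizer of `V * U i x - q * x` over
`0 ≤ x ≤ A_max`. -/
def IsFlowControl (V : ℝ) (i : Fin N) (q a : ℝ) : Prop :=
  a ∈ Set.Icc 0 net.aMax ∧
    ∀ x ∈ Set.Icc 0 net.aMax, V * net.utility i x - q * x ≤ V * net.utility i a - q * a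

/-- `d` is a max-weight scheduling decision: idle if there is no candidate, otherwise exactly one
candidate of maximal weight is scheduled (ties may be broken in any way). -/
def IsMaxWeight (q : Fin N → ℝ) (z : ℝ) (s : ChannelState N) (d : Fin N → ℝ) : Prop :=
  (net.candidates q z s = ∅ ∧ d = 0) ∨
    ∃ j ∈ net.candidates q z s,
      (∀ k ∈ net.candidates q z s, net.weight q z s k ≤ net.weight q z s j) ∧
      d = Pi.single j 1

/-- Block fading: the channel states are independent and identically distributed over the slots
with the given law. `ℱ t` is the information available just before the channel state of slot `t`
is revealed; it contains the states of all earlier slots, and the state of slot `t` is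
independent of it. -/
structure IsBlockFading {Ω : Type*} [mΩ : MeasurableSpace Ω] (μ : Measure Ω)
    (ℱ : Filtration ℕ mΩ) (s : ℕ → Ω → ChannelState N) : Prop where
  measurable : ∀ t, Measurable[ℱ (t + 1)] (s t)
  map_eq : ∀ t, μ.map (s t) = net.law
  indep : ∀ t, Indep (MeasurableSpace.comap (s t) inferInstance) (ℱ t) μ

/-- The queue processes `Q` (real) and `Z` (virtual interference queue), the admitted flows `A`
and the scheduling decisions `d` are generated by the dynamic control algorithm with parameter
`V`, started from the backlogs `q₀` and `z₀`, along the channel states `s`. Decisions, including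
the way in which ties are broken (possibly at random), do not anticipate future channel states. -/
structure IsControlled {Ω : Type*} [mΩ : MeasurableSpace Ω]
    (ℱ : Filtration ℕ mΩ) (V : ℝ) (q₀ : Fin N → ℝ) (z₀ : ℝ)
    (s : ℕ → Ω → ChannelState N) (Q A d : ℕ → Ω → Fin N → ℝ) (Z : ℕ → Ω → ℝ) : Prop where
  queue_zero : ∀ ω i, Q 0 ω i = q₀ i
  queue_succ : ∀ t ω i,
    Q (t + 1) ω i = max (Q t ω i - d t ω i * net.rate i (s t ω)) 0 + A t ω i
  virtual_zero : ∀ ω, Z 0 ω = z₀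
  virtual_succ : ∀ t ω,
    Z (t + 1) ω =
      max (Z t ω - net.gamma + ∑ i, d t ω i * (net.power * interferenceGain (s t ω) i)) 0
  flow_measurable : ∀ t, Measurable[ℱ t] (A t)
  flow : ∀ t ω i, net.IsFlowControl V i (Q t ω i) (A t ω i)
  sched_measurable : ∀ t, Measurable[ℱ (t + 1)] (d t)
  sched : ∀ t ω, net.IsMaxWeight (Q t ω) (Z t ω) (s t ω) (d t ω)

end EdgeNetwork

/-- Long-term average `x i = limsup (1/T) ∑_{t=1}^T A i (t)` of the admitted flow of link `i`,
along the sample path `ω`. -/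
noncomputable def averageRate {N : ℕ} {Ω : Type*} (A : ℕ → Ω → Fin N → ℝ) (ω : Ω) (i : Fin N) :
    ℝ :=
  limsup (fun T : ℕ => (1 / (T : ℝ)) * ∑ t ∈ Finset.Icc 1 T, A t ω i) atTop

/-- Long-term average `limsup (1/T) ∑_{τ<T} ∑ i, 𝔼[Q i (τ)]` of the expected total backlog, as an
extended nonnegative number. -/
noncomputable def averageBacklog {N : ℕ} {Ω : Type*} [MeasurableSpace Ω] (μ : Measure Ω)
    (Q : ℕ → Ω → Fin N → ℝ) : ℝ≥0∞ :=
  limsup (fun T : ℕ =>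
    (∑ τ ∈ Finset.range T, ∑ i, ∫⁻ ω, ENNReal.ofReal (Q τ ω i) ∂μ) / (T : ℝ≥0∞)) atTop

end EdgeControl

/-!
The argument is Lyapunov drift plus penalty with `L(t) = ∑ Q_i(t)² + Z(t)²`, carried out along sample
paths instead of in expectation, because the utility bound is an almost sure one.

*Backlogs.* A utility that is continuously differentiable on `[0, ∞)` is Lipschitz on `[0, A_max]`,
with a constant `m i`. Flow control admits nothing while `Q_i > V m_i`, so `Q_i` never exceeds
`q_i + V m_i + A_max` (`IsControlled.queue_le`). This sure bound is linear in `V`; it gives the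
backlog claim and needs no interior point of the stability region.

*Utility.* Fix a feasible rate vector `x` with scheduling policy `p`. In every slot the max-weight
decision has at least the weight of `p` (`IsMaxWeight.weight_le`), which gives a pathwise one-slot
bound (`IsControlled.drift_le`). Summed over `T` slots, it bounds the accumulated utility from below
by `T ∑ U_i(x_i)`, up to terms of three kinds. Squares of rates are averaged by the law of large
numbers and contribute `O(T / V)`. The initial backlog contributes `O(1)`. Finally there are sums
`∑_t Y(t) f(s(t))` with `f` centred and `Y(t) = Q_i(t)` or `Z(t)` known before `s(t)` is revealed.
Their terms are orthogonal (`integral_sq_sum_mul`), so if the second moments of `Y` are bounded on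
average, they are `o(T)` almost surely along the squares `T = (k + 1)²`; a subsequence is enough,
since the arrival rates are limits superior. For `Y = Q_i` the moment bound is the sure bound on the
backlogs. The virtual queue `Z` has no such bound. A scheduled link has nonnegative weight, though,
so `Z` times the interference caused is at most `∑ Q_i R_i`, and the drift of `Z³` bounds the second
moments of `Z` on average (`IsControlled.exists_sum_integral_virtual_sq_le`). Jensen's inequality
and the continuity of the utilities turn average utilities into utilities of average rates
(`le_sum_utility_averageRate`).
-/

namespace EdgeControl

/-! ### Interference gains and queue updates -/

lemma measurable_interferenceGain {N : ℕ} (i : Fin N) :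
    Measurable fun x : ChannelState N => interferenceGain x i := by
  unfold interferenceGain; fun_prop

lemma queue_sq_le {q r a : ℝ} (hq : 0 ≤ q) (hr : 0 ≤ r) (ha : 0 ≤ a) :
    (max (q - r) 0 + a) ^ 2 ≤ q ^ 2 + a ^ 2 + r ^ 2 + 2 * q * (a - r) := by
  rcases max_cases (q - r) 0 with ⟨h, _⟩ | ⟨h, _⟩ <;> rw [h] <;>
    nlinarith [mul_nonneg hr ha, mul_nonneg hq ha, sq_nonneg (q - r)]

lemma max_zero_sq_le (u : ℝ) : (max u 0) ^ 2 ≤ u ^ 2 := by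
  rcases max_cases u 0 with ⟨h, _⟩ | ⟨h, _⟩ <;> rw [h]
  nlinarith [sq_nonneg u]

lemma max_zero_cube_le {z y b : ℝ} (hz : 0 ≤ z) (hy : |y| ≤ b) :
    (max (z + y) 0) ^ 3 ≤ z ^ 3 + 3 * z ^ 2 * y + 3 * b ^ 2 * z + b ^ 3 := by
  obtain ⟨h1, h2⟩ := abs_le.1 hy
  have hb : 0 ≤ b := (abs_nonneg y).trans hy
  have hy2 : y ^ 2 ≤ b ^ 2 := sq_le_sq' h1 h2
  have hz2 : z * y ^ 2 ≤ z * b ^ 2 := mul_le_mul_of_nonneg_left hy2 hz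
  rcases max_cases (z + y) 0 with ⟨h, _⟩ | ⟨h, h0⟩ <;> rw [h]
  · have : y ^ 3 ≤ b ^ 3 := Odd.pow_le_pow (by decide) |>.2 h2
    nlinarith
  · have h3 : (-b) ^ 3 ≤ (z + y) ^ 3 := Odd.pow_le_pow (by decide) |>.2 (by linarith)
    have h4 : y ^ 3 ≤ 0 := Odd.pow_nonpos (by decide) (by linarith)
    nlinarith

namespace EdgeNetwork

variable {N : ℕ} (net : EdgeNetwork N)

/-! ### Max-weight decisions -/

section MaxWeight

variable {net} {q : Fin N → ℝ} {z : ℝ} {s : ChannelState N} {d : Fin N → ℝ}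

lemma interference_nonneg (s : ChannelState N) (i : Fin N) :
    0 ≤ net.power * interferenceGain s i :=
  mul_nonneg net.power_pos.le (NNReal.coe_nonneg _)

lemma IsMaxWeight.mem_zero_one (h : net.IsMaxWeight q z s d) (i : Fin N) :
    d i = 0 ∨ d i = 1 := by
  rcases h with ⟨-, rfl⟩ | ⟨j, -, -, rfl⟩
  · exact Or.inl rfl
  · by_cases hij : i = j
    · subst hij; simp
    · simp [hij]

lemma IsMaxWeight.nonneg (h : net.IsMaxWeight q z s d) (i : Fin N) : 0 ≤ d i := by
  rcases h.mem_zero_one i with h | h <;> simp [h]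

lemma IsMaxWeight.le_one (h : net.IsMaxWeight q z s d) (i : Fin N) : d i ≤ 1 := by
  rcases h.mem_zero_one i with h | h <;> simp [h]

/-- The scheduled link meets the instantaneous interference constraint. -/
lemma IsMaxWeight.interference_le (h : net.IsMaxWeight q z s d) :
    ∑ i, d i * (net.power * interferenceGain s i) ≤ max net.nu 0 := by
  rcases h with ⟨-, rfl⟩ | ⟨j, hj, -, rfl⟩
  · simp
  · simpa [Pi.single_apply] using Or.inl hj.2

/-- Max-weight scheduling maximizes the total weight, in each single slot, over all randomized
decisions that respect the instantaneous interference threshold. -/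
lemma IsMaxWeight.weight_le (h : net.IsMaxWeight q z s d) {p : Fin N → ℝ}
    (hp : ∀ i, 0 ≤ p i) (hp1 : ∑ i, p i ≤ 1)
    (hnu : ∀ i, net.nu < net.power * interferenceGain s i → p i = 0) :
    ∑ i, p i * net.weight q z s i ≤ ∑ i, d i * net.weight q z s i := by
  have key : ∀ M : ℝ, 0 ≤ M → (∀ k ∈ net.candidates q z s, net.weight q z s k ≤ M) →
      ∑ i, p i * net.weight q z s i ≤ M := by
    intro M hM hk
    calc ∑ i, p i * net.weight q z s i ≤ ∑ i, p i * M := by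
          refine Finset.sum_le_sum fun i _ => ?_
          by_cases hi : net.nu < net.power * interferenceGain s i
          · simp [hnu i hi]
          · refine mul_le_mul_of_nonneg_left ?_ (hp i)
            by_cases hw : 0 ≤ net.weight q z s i
            · exact hk i ⟨hw, not_lt.1 hi⟩
            · exact (not_le.1 hw).le.trans hM
      _ = (∑ i, p i) * M := by rw [Finset.sum_mul]
      _ ≤ M := mul_le_of_le_one_left hM hp1
  rcases h with ⟨hC, rfl⟩ | ⟨j, hj, hmax, rfl⟩
  · simpa using key 0 le_rfl (by simp [hC])
  · simpa [Pi.single_apply] using key _ hj.1 hmax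

/-- A link is scheduled only if its weight is nonnegative, so the virtual backlog times the
interference caused is at most the rate reward. -/
lemma IsMaxWeight.virtual_mul_le (h : net.IsMaxWeight q z s d) (hq : ∀ i, 0 ≤ q i) :
    z * ∑ i, d i * (net.power * interferenceGain s i) ≤ ∑ i, q i * net.rate i s := by
  have h0 : 0 ≤ ∑ i, d i * net.weight q z s i := by
    simpa using h.weight_le (p := 0) (by simp) (by simp) (by simp)
  calc z * ∑ i, d i * (net.power * interferenceGain s i)
      = ∑ i, d i * (q i * net.rate i s) - ∑ i, d i * net.weight q z s i := by
        rw [Finset.mul_sum, ← Finset.sum_sub_distrib]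
        refine Finset.sum_congr rfl fun i _ => ?_
        rw [weight]; ring
    _ ≤ ∑ i, d i * (q i * net.rate i s) := by linarith
    _ ≤ ∑ i, q i * net.rate i s := Finset.sum_le_sum fun i _ =>
        mul_le_of_le_one_left (mul_nonneg (hq i) (net.rate_nonneg i s)) (h.le_one i)

end MaxWeight

/-! ### Flow control -/

/-- The utility functions grow at most linearly on `[0, A_max]`. -/
lemma exists_utility_le (i : Fin N) :
    ∃ m : ℝ, 0 ≤ m ∧ ∀ x ∈ Set.Icc 0 net.aMax, net.utility i x ≤ m * x := by
  have hc : ContDiffOn ℝ 1 (net.utility i) (Set.Icc 0 net.aMax) :=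
    (net.utility_contDiff i).mono Set.Icc_subset_Ici_self
  obtain ⟨K, hK⟩ := hc.exists_lipschitzOnWith one_ne_zero (convex_Icc _ _) isCompact_Icc
  refine ⟨K, K.2, fun x hx => ?_⟩
  have := hK.dist_le_mul x hx 0 ⟨le_rfl, net.aMax_pos.le⟩
  rw [Real.dist_eq, Real.dist_eq, net.utility_zero, sub_zero, sub_zero, abs_of_nonneg hx.1] at this
  exact (le_abs_self _).trans this

lemma utility_nonneg (i : Fin N) {x : ℝ} (hx : 0 ≤ x) : 0 ≤ net.utility i x := by
  rw [← net.utility_zero i]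
  exact net.utility_mono i Set.self_mem_Ici hx hx

variable {net} in
/-- Flow control admits nothing once the backlog exceeds `V` times a bound `m` for the slope of
the utility. -/
lemma IsFlowControl.eq_zero {V q a m : ℝ} {i : Fin N} (hV : 0 ≤ V)
    (hm : ∀ x ∈ Set.Icc 0 net.aMax, net.utility i x ≤ m * x)
    (h : net.IsFlowControl V i q a) (hq : V * m < q) : a = 0 := by
  have h0 := h.2 0 ⟨le_rfl, net.aMax_pos.le⟩
  rw [net.utility_zero] at h0
  have h1 := mul_le_mul_of_nonneg_left (hm a h.1) hV
  by_contra hne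
  have hpos : 0 < a := lt_of_le_of_ne h.1.1 (Ne.symm hne)
  nlinarith

/-! ### Queue bounds and pathwise drift -/

namespace IsControlled

variable {net} {Ω : Type*} [mΩ : MeasurableSpace Ω] {ℱ : Filtration ℕ mΩ} {V : ℝ}
  {q₀ : Fin N → ℝ} {z₀ : ℝ} {s : ℕ → Ω → ChannelState N} {Q A d : ℕ → Ω → Fin N → ℝ}
  {Z : ℕ → Ω → ℝ}

section
variable (h : net.IsControlled ℱ V q₀ z₀ s Q A d Z)
include h

lemma queue_nonneg (hq₀ : ∀ i, 0 ≤ q₀ i) (t : ℕ) (ω : Ω) (i : Fin N) : 0 ≤ Q t ω i := by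
  cases t with
  | zero => rw [h.queue_zero]; exact hq₀ i
  | succ t => rw [h.queue_succ]; exact add_nonneg (le_max_right _ _) (h.flow t ω i).1.1

lemma virtual_nonneg (hz₀ : 0 ≤ z₀) (t : ℕ) (ω : Ω) : 0 ≤ Z t ω := by
  cases t with
  | zero => rw [h.virtual_zero]; exact hz₀
  | succ t => rw [h.virtual_succ]; exact le_max_right _ _

/-- The backlogs are bounded surely: a link stops admitting traffic once its backlog exceeds
`V` times the slope bound of its utility. -/
lemma queue_le (hV : 0 ≤ V) (hq₀ : ∀ i, 0 ≤ q₀ i) {m : Fin N → ℝ} (hm0 : ∀ i, 0 ≤ m i)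
    (hm : ∀ i, ∀ x ∈ Set.Icc 0 net.aMax, net.utility i x ≤ m i * x) (t : ℕ) (ω : Ω) (i : Fin N) :
    Q t ω i ≤ q₀ i + V * m i + net.aMax := by
  have hVm := mul_nonneg hV (hm0 i)
  have ha := net.aMax_pos
  induction t with
  | zero => rw [h.queue_zero]; linarith
  | succ t ih =>
    have hQ := h.queue_nonneg hq₀ t ω i
    have hmax : max (Q t ω i - d t ω i * net.rate i (s t ω)) 0 ≤ Q t ω i :=
      max_le (sub_le_self _ (mul_nonneg ((h.sched t ω).nonneg i) (net.rate_nonneg _ _))) hQ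
    rw [h.queue_succ]
    by_cases hlt : V * m i < Q t ω i
    · rw [(h.flow t ω i).eq_zero hV (hm i) hlt]; linarith
    · linarith [(h.flow t ω i).1.2, hq₀ i]

lemma virtual_le (hz₀ : 0 ≤ z₀) (t : ℕ) (ω : Ω) : Z t ω ≤ z₀ + t * max net.nu 0 := by
  induction t with
  | zero => simp [h.virtual_zero]
  | succ t ih =>
    rw [h.virtual_succ]
    push_cast
    have := (h.sched t ω).interference_le
    have := net.gamma_pos
    have : 0 ≤ max net.nu 0 := le_max_right _ _
    refine max_le (by linarith) (by positivity)

lemma measurable_queue (hs : ∀ t, Measurable[ℱ (t + 1)] (s t)) (t : ℕ) (i : Fin N) :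
    Measurable[ℱ t] fun ω => Q t ω i := by
  induction t with
  | zero => simp only [h.queue_zero]; exact measurable_const
  | succ t ih =>
    simp only [h.queue_succ]
    have h1 : Measurable[ℱ (t + 1)] fun ω => Q t ω i := ih.mono (ℱ.mono t.le_succ) le_rfl
    have h2 : Measurable[ℱ (t + 1)] fun ω => d t ω i :=
      (measurable_pi_apply i).comp (h.sched_measurable t)
    have h3 : Measurable[ℱ (t + 1)] fun ω => net.rate i (s t ω) :=
      (net.rate_measurable i).comp (hs t)
    have h4 : Measurable[ℱ (t + 1)] fun ω => A t ω i :=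
      ((measurable_pi_apply i).comp (h.flow_measurable t)).mono (ℱ.mono t.le_succ) le_rfl
    exact ((h1.sub (h2.mul h3)).max measurable_const).add h4

lemma measurable_virtual (hs : ∀ t, Measurable[ℱ (t + 1)] (s t)) (t : ℕ) :
    Measurable[ℱ t] (Z t) := by
  induction t with
  | zero =>
    have : Z 0 = fun _ => z₀ := funext h.virtual_zero
    rw [this]; exact measurable_const
  | succ t ih =>
    have : Z (t + 1) = _ := funext (h.virtual_succ t)
    rw [this]
    have h1 : Measurable[ℱ (t + 1)] (Z t) := ih.mono (ℱ.mono t.le_succ) le_rfl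
    refine ((h1.sub measurable_const).add ?_).max measurable_const
    refine Finset.measurable_fun_sum _ fun i _ => ?_
    exact ((measurable_pi_apply i).comp (h.sched_measurable t)).mul
      (((measurable_interferenceGain i).comp (hs t)).const_mul _)

/-- One-slot drift-plus-penalty inequality, compared pathwise with an arbitrary feasible pair of
inputs `x` and scheduling probabilities `p`. -/
lemma drift_le (hq₀ : ∀ i, 0 ≤ q₀ i) (hz₀ : 0 ≤ z₀) (t : ℕ) (ω : Ω) {x p : Fin N → ℝ}
    (hx : ∀ i, x i ∈ Set.Icc 0 net.aMax) (hp : ∀ i, 0 ≤ p i) (hp1 : ∑ i, p i ≤ 1)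
    (hnu : ∀ i, net.nu < net.power * interferenceGain (s t ω) i → p i = 0) :
    (∑ i, Q (t + 1) ω i ^ 2 + Z (t + 1) ω ^ 2) - (∑ i, Q t ω i ^ 2 + Z t ω ^ 2)
      - 2 * V * ∑ i, net.utility i (A t ω i) ≤
    (N * net.aMax ^ 2 + net.gamma ^ 2 + max net.nu 0 ^ 2) + ∑ i, net.rate i (s t ω) ^ 2
      - 2 * V * ∑ i, net.utility i (x i)
      + 2 * (∑ i, Q t ω i * (x i - p i * net.rate i (s t ω))
      + Z t ω * (∑ i, net.power * interferenceGain (s t ω) i * p i - net.gamma)) := by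
  have hQ := h.queue_nonneg hq₀ t ω
  have hZ := h.virtual_nonneg hz₀ t ω
  have hd := h.sched t ω
  set δ := ∑ i, d t ω i * (net.power * interferenceGain (s t ω) i) with hδ
  have hδ0 : 0 ≤ δ := Finset.sum_nonneg fun i _ =>
    mul_nonneg (hd.nonneg i) (interference_nonneg _ _)
  have hδ1 : δ ≤ max net.nu 0 := hd.interference_le
  have hγ := net.gamma_pos
  have hz : Z (t + 1) ω ^ 2 ≤ Z t ω ^ 2 + net.gamma ^ 2 + max net.nu 0 ^ 2
      + 2 * Z t ω * (δ - net.gamma) := by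
    rw [h.virtual_succ, ← hδ]
    refine (max_zero_sq_le _).trans ?_
    nlinarith [mul_nonneg hδ0 hγ.le]
  have hqi : ∀ i, Q (t + 1) ω i ^ 2 ≤ Q t ω i ^ 2 + net.aMax ^ 2 + net.rate i (s t ω) ^ 2
      + 2 * (Q t ω i * A t ω i - V * net.utility i (A t ω i))
      + 2 * V * net.utility i (A t ω i)
      - 2 * (d t ω i * (Q t ω i * net.rate i (s t ω))) := by
    intro i
    have hA := (h.flow t ω i).1
    have hR := net.rate_nonneg i (s t ω)
    have h1 := queue_sq_le (hQ i) (mul_nonneg (hd.nonneg i) hR) hA.1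
    rw [← h.queue_succ] at h1
    have h2 : A t ω i ^ 2 ≤ net.aMax ^ 2 := pow_le_pow_left₀ hA.1 hA.2 2
    have h3 : (d t ω i * net.rate i (s t ω)) ^ 2 ≤ net.rate i (s t ω) ^ 2 :=
      pow_le_pow_left₀ (mul_nonneg (hd.nonneg i) hR) (mul_le_of_le_one_left hR (hd.le_one i)) 2
    nlinarith
  have hfl : ∀ i, Q t ω i * A t ω i - V * net.utility i (A t ω i) ≤
      Q t ω i * x i - V * net.utility i (x i) := fun i => by
    linarith [(h.flow t ω i).2 (x i) (hx i)]
  have hsum := Finset.sum_le_sum fun i (_ : i ∈ Finset.univ) =>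
    (hqi i).trans (by linarith [hfl i] : _ ≤ Q t ω i ^ 2 + net.aMax ^ 2 + net.rate i (s t ω) ^ 2
      + 2 * (Q t ω i * x i - V * net.utility i (x i))
      + 2 * V * net.utility i (A t ω i)
      - 2 * (d t ω i * (Q t ω i * net.rate i (s t ω))))
  have hw := hd.weight_le hp hp1 hnu
  simp only [weight, mul_sub, Finset.sum_sub_distrib, Finset.sum_add_distrib, ← Finset.mul_sum,
    Finset.sum_const, Finset.card_univ, Fintype.card_fin, nsmul_eq_mul] at hsum hw ⊢
  have e1 : ∑ i, d t ω i * (net.power * Z t ω * interferenceGain (s t ω) i) = Z t ω * δ := by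
    rw [hδ, Finset.mul_sum]; exact Finset.sum_congr rfl fun i _ => by ring
  have e2 : ∑ i, p i * (net.power * Z t ω * interferenceGain (s t ω) i) =
      Z t ω * ∑ i, net.power * interferenceGain (s t ω) i * p i := by
    rw [Finset.mul_sum]; exact Finset.sum_congr rfl fun i _ => by ring
  have e3 : ∑ i, Q t ω i * (p i * net.rate i (s t ω)) =
      ∑ i, p i * (Q t ω i * net.rate i (s t ω)) :=
    Finset.sum_congr rfl fun i _ => by ring
  rw [e1, e2] at hw
  rw [e3]
  linarith

/-- The cubic drift of the virtual queue. -/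
lemma virtual_cube_le (hq₀ : ∀ i, 0 ≤ q₀ i) (hz₀ : 0 ≤ z₀) (t : ℕ) (ω : Ω) :
    Z (t + 1) ω ^ 3 ≤ Z t ω ^ 3 - 3 * net.gamma * Z t ω ^ 2
      + 3 * Z t ω * (∑ i, Q t ω i * net.rate i (s t ω) + (net.gamma + max net.nu 0) ^ 2)
      + (net.gamma + max net.nu 0) ^ 3 := by
  have hZ := h.virtual_nonneg hz₀ t ω
  have hd := h.sched t ω
  have hv := hd.virtual_mul_le (h.queue_nonneg hq₀ t ω)
  rw [h.virtual_succ]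
  set δ := ∑ i, d t ω i * (net.power * interferenceGain (s t ω) i) with hδ
  have hδ0 : 0 ≤ δ := Finset.sum_nonneg fun i _ =>
    mul_nonneg (hd.nonneg i) (interference_nonneg _ _)
  have hδ1 : δ ≤ max net.nu 0 := hd.interference_le
  have hγ := net.gamma_pos
  have h0 : 0 ≤ max net.nu 0 := le_max_right _ _
  have hc := max_zero_cube_le (y := δ - net.gamma) (b := net.gamma + max net.nu 0) hZ
    (abs_le.2 ⟨by linarith, by linarith⟩)
  rw [show Z t ω - net.gamma + δ = Z t ω + (δ - net.gamma) by ring]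
  have := mul_le_mul_of_nonneg_left hv hZ
  nlinarith

end

end IsControlled

end EdgeNetwork

/-! ### Sums of orthogonal increments -/

section MartingaleTransform

variable {Ω : Type*} [mΩ : MeasurableSpace Ω] {μ : Measure Ω}
  {ℱ : Filtration ℕ mΩ} {X Y : ℕ → Ω → ℝ}

lemma indepFun_of_measurable_of_indep {m : MeasurableSpace Ω} {X Y : Ω → ℝ}
    (hind : Indep (MeasurableSpace.comap X inferInstance) m μ) (hY : Measurable[m] Y) :
    IndepFun X Y μ :=
  (IndepFun_iff_Indep X Y μ).2 (indep_of_indep_of_le_right hind hY.comap_le)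

lemma memLp_two_mul_of_indepFun {X Y : Ω → ℝ} (h : IndepFun X Y μ) (hX : MemLp X 2 μ)
    (hY : MemLp Y 2 μ) : MemLp (fun ω => Y ω * X ω) 2 μ := by
  refine (memLp_two_iff_integrable_sq (hY.1.mul hX.1)).2 ?_
  have h2 : IndepFun (fun ω => X ω ^ 2) (fun ω => Y ω ^ 2) μ :=
    h.comp (φ := fun x : ℝ => x ^ 2) (ψ := fun x : ℝ => x ^ 2) (by fun_prop) (by fun_prop)
  refine (h2.integrable_mul hX.integrable_sq hY.integrable_sq).congr (.of_forall fun ω => ?_)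
  simp only [Pi.mul_apply]; ring

/-- Orthogonality of martingale differences: if `X t` is centred and independent of the past
`ℱ t`, and `Y t` is `ℱ t`-measurable, then the second moment of `∑ t < T, Y t * X t` is the sum of
the second moments. -/
lemma integral_sq_sum_mul [IsFiniteMeasure μ] (hXm : ∀ t, Measurable[ℱ (t + 1)] (X t))
    (hYm : ∀ t, Measurable[ℱ t] (Y t))
    (hind : ∀ t, Indep (MeasurableSpace.comap (X t) inferInstance) (ℱ t) μ)
    (hX : ∀ t, MemLp (X t) 2 μ) (hY : ∀ t, MemLp (Y t) 2 μ) (hX0 : ∀ t, ∫ ω, X t ω ∂μ = 0)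
    (T : ℕ) :
    MemLp (fun ω => ∑ t ∈ Finset.range T, Y t ω * X t ω) 2 μ ∧
    ∫ ω, (∑ t ∈ Finset.range T, Y t ω * X t ω) ^ 2 ∂μ =
      ∑ t ∈ Finset.range T, (∫ ω, Y t ω ^ 2 ∂μ) * ∫ ω, X t ω ^ 2 ∂μ := by
  have hSm : ∀ T, Measurable[ℱ T] fun ω => ∑ t ∈ Finset.range T, Y t ω * X t ω := fun T =>
    Finset.measurable_fun_sum _ fun t ht =>
      ((hYm t).mono (ℱ.mono (Finset.mem_range.1 ht).le) le_rfl).mul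
        ((hXm t).mono (ℱ.mono (Finset.mem_range.1 ht)) le_rfl)
  induction T with
  | zero => simp
  | succ T ih =>
    obtain ⟨hS, ih⟩ := ih
    set S := fun ω => ∑ t ∈ Finset.range T, Y t ω * X t ω
    have hXY : IndepFun (X T) (Y T) μ := indepFun_of_measurable_of_indep (hind T) (hYm T)
    have hD : MemLp (fun ω => Y T ω * X T ω) 2 μ := memLp_two_mul_of_indepFun hXY (hX T) (hY T)
    have hXSY : IndepFun (X T) (fun ω => S ω * Y T ω) μ :=
      indepFun_of_measurable_of_indep (hind T) ((hSm T).mul (hYm T))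
    have hSY : Integrable (fun ω => S ω * Y T ω) μ := hS.integrable_mul (hY T)
    have hSD : Integrable (fun ω => X T ω * (S ω * Y T ω)) μ :=
      hXSY.integrable_mul ((hX T).integrable one_le_two) hSY
    have hcross : ∫ ω, X T ω * (S ω * Y T ω) ∂μ = 0 := by
      rw [hXSY.integral_fun_mul_eq_mul_integral (hX T).1 hSY.1, hX0 T, zero_mul]
    have hsq : ∫ ω, X T ω ^ 2 * Y T ω ^ 2 ∂μ = (∫ ω, X T ω ^ 2 ∂μ) * ∫ ω, Y T ω ^ 2 ∂μ :=
      hXY.integral_fun_comp_mul_comp (f := fun x : ℝ => x ^ 2) (g := fun x : ℝ => x ^ 2)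
        (hX T).1.aemeasurable (hY T).1.aemeasurable (by fun_prop) (by fun_prop)
    have hDsq : Integrable (fun ω => X T ω ^ 2 * Y T ω ^ 2) μ :=
      hD.integrable_sq.congr (.of_forall fun ω => by ring)
    have hSSD : Integrable (fun ω => S ω ^ 2 + 2 * (X T ω * (S ω * Y T ω))) μ :=
      hS.integrable_sq.add (hSD.const_mul 2)
    simp only [Finset.sum_range_succ]
    refine ⟨hS.add hD, ?_⟩
    calc ∫ ω, (S ω + Y T ω * X T ω) ^ 2 ∂μ
        = ∫ ω, S ω ^ 2 + 2 * (X T ω * (S ω * Y T ω)) + X T ω ^ 2 * Y T ω ^ 2 ∂μ := by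
          congr 1; ext ω; ring
      _ = _ := by
          rw [integral_add hSSD hDsq,
            integral_add hS.integrable_sq (hSD.const_mul 2), integral_const_mul, hcross, hsq, ih]
          ring

/-- If the second moments of `S T` grow at most linearly, then `S T / T` tends to zero almost
surely along the squares. -/
lemma ae_tendsto_div_sq_of_integral_sq_le {S : ℕ → Ω → ℝ} (hS : ∀ T, MemLp (S T) 2 μ) {K : ℝ}
    (hK : ∀ T : ℕ, ∫ ω, S T ω ^ 2 ∂μ ≤ K * (T + 1)) :
    ∀ᵐ ω ∂μ, Tendsto (fun k : ℕ => S ((k + 1) ^ 2) ω / ((k + 1) ^ 2 : ℕ)) atTop (nhds 0) := by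
  have hK0 : 0 ≤ K := by
    have := (integral_nonneg fun ω => sq_nonneg (S 0 ω)).trans (hK 0)
    simpa using this
  set F : ℕ → Ω → ℝ := fun k ω => (S ((k + 1) ^ 2) ω / ((k + 1) ^ 2 : ℕ)) ^ 2 with hF
  have hFi : ∀ k, Integrable (F k) μ := fun k => by
    simp only [hF, div_pow]
    exact (hS _).integrable_sq.div_const _
  have hFle : ∀ k, ∫ ω, F k ω ∂μ ≤ 2 * K * (1 / ((k + 1 : ℕ) : ℝ) ^ 2) := fun k => by
    simp only [hF, div_pow]
    rw [integral_div, div_le_iff₀ (by positivity)]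
    refine (hK _).trans ?_
    push_cast
    have h1 : (1 : ℝ) ≤ (k + 1) ^ 2 := one_le_pow₀ (by linarith [Nat.cast_nonneg (α := ℝ) k])
    have h2 : 2 * K * (1 / ((k : ℝ) + 1) ^ 2) * (((k : ℝ) + 1) ^ 2) ^ 2 =
        2 * K * ((k : ℝ) + 1) ^ 2 := by field_simp
    rw [h2]
    nlinarith
  have hsum : Summable fun k : ℕ => 2 * K * (1 / ((k + 1 : ℕ) : ℝ) ^ 2) :=
    ((summable_nat_add_iff 1).2 (Real.summable_one_div_nat_pow.2 one_lt_two)).mul_left _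
  have hlin : ∫⁻ ω, ∑' k, ENNReal.ofReal (F k ω) ∂μ ≠ ⊤ := by
    rw [lintegral_tsum fun k => (hFi k).1.aemeasurable.ennreal_ofReal]
    refine ne_top_of_le_ne_top hsum.tsum_ofReal_ne_top (ENNReal.tsum_le_tsum fun k => ?_)
    rw [← ofReal_integral_eq_lintegral_ofReal (hFi k) (.of_forall fun ω => sq_nonneg _)]
    exact ENNReal.ofReal_le_ofReal (hFle k)
  filter_upwards [ae_lt_top' (AEMeasurable.tsum
    fun k => (hFi k).1.aemeasurable.ennreal_ofReal) hlin] with ω hω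
  have h0 := ENNReal.tendsto_atTop_zero_of_tsum_ne_top hω.ne
  have h1 : Tendsto (fun k => F k ω) atTop (nhds 0) := by
    have := (ENNReal.tendsto_toReal ENNReal.zero_ne_top).comp h0
    refine this.congr fun k => ?_
    simp [hF, ENNReal.toReal_ofReal, sq_nonneg]
  have h2 := h1.sqrt
  simp only [hF, Real.sqrt_sq_eq_abs, Real.sqrt_zero] at h2
  exact (tendsto_zero_iff_abs_tendsto_zero _).2 h2

end MartingaleTransform

namespace EdgeNetwork

variable {N : ℕ} {net : EdgeNetwork N} {Ω : Type*} [mΩ : MeasurableSpace Ω] {μ : Measure Ω}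
  {ℱ : Filtration ℕ mΩ} {s : ℕ → Ω → ChannelState N}

/-! ### Averages along the channel states -/

namespace IsBlockFading

variable (hb : net.IsBlockFading μ ℱ s)
include hb

lemma measurable' (t : ℕ) : Measurable (s t) := (hb.measurable t).mono (ℱ.le _) le_rfl

lemma measurePreserving (t : ℕ) : MeasurePreserving (s t) μ net.law :=
  ⟨hb.measurable' t, hb.map_eq t⟩

lemma integral_comp {f : ChannelState N → ℝ} (hf : Measurable f) (t : ℕ) :
    ∫ ω, f (s t ω) ∂μ = ∫ x, f x ∂net.law := by
  rw [← hb.map_eq t, integral_map (hb.measurable' t).aemeasurable hf.aestronglyMeasurable]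

lemma indep_comp {f : ChannelState N → ℝ} (hf : Measurable f) (t : ℕ) :
    Indep (MeasurableSpace.comap (fun ω => f (s t ω)) inferInstance) (ℱ t) μ := by
  refine indep_of_indep_of_le_left (hb.indep t) ?_
  exact (hf.comp (comap_measurable (s t))).comap_le

/-- Law of large numbers for functions of the channel states. -/
lemma ae_tendsto_average {f : ChannelState N → ℝ} (hf : Measurable f)
    (hfi : Integrable f net.law) :
    ∀ᵐ ω ∂μ, Tendsto (fun n : ℕ => (∑ t ∈ Finset.range n, f (s t ω)) / n) atTop
      (nhds (∫ x, f x ∂net.law)) := by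
  rw [← hb.integral_comp hf 0]
  refine strong_law_ae_real (fun t ω => f (s t ω))
    ((hb.measurePreserving 0).integrable_comp_of_integrable hfi) ?_ fun t => ?_
  · have key : ∀ i j, i < j → IndepFun (fun ω => f (s j ω)) (fun ω => f (s i ω)) μ :=
      fun i j hij => indepFun_of_measurable_of_indep (hb.indep_comp hf j)
        ((hf.comp (hb.measurable i)).mono (ℱ.mono hij) le_rfl)
    intro i j hij
    rcases lt_or_gt_of_ne hij with h | h
    · exact (key i j h).symm
    · exact key j i h
  · refine ⟨(hf.comp (hb.measurable' t)).aemeasurable, (hf.comp (hb.measurable' 0)).aemeasurable, ?_⟩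
    have : ∀ t, μ.map (fun ω => f (s t ω)) = net.law.map f := fun t => by
      rw [← hb.map_eq t, Measure.map_map hf (hb.measurable' t)]; rfl
    rw [this, this]

/-- Averages of a centred square-integrable function of the channel state, weighted by
nonanticipating factors with second moments bounded on average, vanish along the squares. -/
lemma ae_tendsto_weighted_average [IsFiniteMeasure μ] {f : ChannelState N → ℝ}
    (hf : Measurable f) (hf2 : MemLp f 2 net.law) (hf0 : ∫ x, f x ∂net.law = 0)
    {Y : ℕ → Ω → ℝ} (hYm : ∀ t, Measurable[ℱ t] (Y t)) (hY : ∀ t, MemLp (Y t) 2 μ) {K : ℝ}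
    (hK : ∀ T : ℕ, ∑ t ∈ Finset.range T, ∫ ω, Y t ω ^ 2 ∂μ ≤ K * (T + 1)) :
    ∀ᵐ ω ∂μ, Tendsto (fun k : ℕ => (∑ t ∈ Finset.range ((k + 1) ^ 2), Y t ω * f (s t ω)) /
      ((k + 1) ^ 2 : ℕ)) atTop (nhds 0) := by
  have key := integral_sq_sum_mul (X := fun t ω => f (s t ω)) (fun t => hf.comp (hb.measurable t))
    hYm (hb.indep_comp hf) (fun t => hf2.comp_measurePreserving (hb.measurePreserving t)) hY
    (fun t => by rw [hb.integral_comp hf, hf0])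
  refine ae_tendsto_div_sq_of_integral_sq_le
    (S := fun T ω => ∑ t ∈ Finset.range T, Y t ω * f (s t ω))
    (K := K * ∫ x, f x ^ 2 ∂net.law) (fun T => (key T).1) fun T => ?_
  rw [(key T).2]
  simp only [hb.integral_comp (hf.pow_const 2)]
  rw [← Finset.sum_mul, mul_right_comm]
  exact mul_le_mul_of_nonneg_right (hK T) (integral_nonneg fun x => sq_nonneg _)

end IsBlockFading

/-! ### Moments of the virtual queue -/

namespace IsControlled

variable {V : ℝ} {q₀ : Fin N → ℝ} {z₀ : ℝ} {Q A d : ℕ → Ω → Fin N → ℝ} {Z : ℕ → Ω → ℝ}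

lemma memLp_virtual [IsFiniteMeasure μ] (h : net.IsControlled ℱ V q₀ z₀ s Q A d Z)
    (hb : net.IsBlockFading μ ℱ s) (hz₀ : 0 ≤ z₀) (t : ℕ) (p : ℝ≥0∞) : MemLp (Z t) p μ := by
  refine MemLp.of_bound
    ((h.measurable_virtual hb.measurable t).mono (ℱ.le t) le_rfl).aestronglyMeasurable
    (z₀ + t * max net.nu 0) (.of_forall fun ω => ?_)
  rw [Real.norm_of_nonneg (h.virtual_nonneg hz₀ t ω)]
  exact h.virtual_le hz₀ t ω

/-- The second moments of the virtual backlog are bounded on average. -/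
lemma exists_sum_integral_virtual_sq_le [IsProbabilityMeasure μ]
    (h : net.IsControlled ℱ V q₀ z₀ s Q A d Z)
    (hb : net.IsBlockFading μ ℱ s) (hq₀ : ∀ i, 0 ≤ q₀ i) (hz₀ : 0 ≤ z₀) {c : ℝ}
    (hc : ∀ t ω i, Q t ω i ≤ c) :
    ∃ K : ℝ, ∀ T : ℕ, ∑ t ∈ Finset.range T, ∫ ω, Z t ω ^ 2 ∂μ ≤ K * (T + 1) := by
  have hγ := net.gamma_pos
  set b := net.gamma + max net.nu 0
  have hb0 : 0 ≤ b := add_nonneg hγ.le (le_max_right _ _)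
  -- the cross term of the cubic drift is at most `3 * Z * √f`; AM-GM absorbs it into `γ * Z ^ 2`
  set f : ChannelState N → ℝ := fun x => (∑ i, c * net.rate i x + b ^ 2) ^ 2
  have hfm : Measurable f := by
    have := net.rate_measurable
    fun_prop
  have hfi : Integrable f net.law := by
    have := net.isProb
    refine MemLp.integrable_sq (f := fun x => ∑ i, c * net.rate i x + b ^ 2) ?_
    refine MemLp.add (memLp_finsetSum _ fun i _ => ?_) (memLp_const _)
    exact ((memLp_two_iff_integrable_sq (net.rate_measurable i).aestronglyMeasurable).2
      (net.rate_sq_integrable i)).const_mul c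
  set G := ∫ x, f x ∂net.law
  set k := 9 / (4 * net.gamma) * G + b ^ 3
  have hG0 : 0 ≤ G := integral_nonneg fun x => sq_nonneg _
  have step : ∀ t ω, Z (t + 1) ω ^ 3 + 2 * net.gamma * Z t ω ^ 2 ≤
      Z t ω ^ 3 + 9 / (4 * net.gamma) * f (s t ω) + b ^ 3 := by
    intro t ω
    have hZ := h.virtual_nonneg hz₀ t ω
    have h1 := h.virtual_cube_le hq₀ hz₀ t ω
    have h2 : ∑ i, Q t ω i * net.rate i (s t ω) ≤ ∑ i, c * net.rate i (s t ω) :=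
      Finset.sum_le_sum fun i _ => mul_le_mul_of_nonneg_right (hc t ω i) (net.rate_nonneg _ _)
    set r := ∑ i, c * net.rate i (s t ω) + b ^ 2 with hr
    have h3 := mul_le_mul_of_nonneg_left (add_le_add_left h2 (b ^ 2)) hZ
    rw [← hr] at h3
    have h4 : 3 * (Z t ω * r) ≤ net.gamma * Z t ω ^ 2 + 9 / (4 * net.gamma) * r ^ 2 := by
      have : 0 ≤ (2 * net.gamma * Z t ω - 3 * r) ^ 2 / (4 * net.gamma) := by positivity
      have e : (2 * net.gamma * Z t ω - 3 * r) ^ 2 / (4 * net.gamma) =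
        net.gamma * Z t ω ^ 2 + 9 / (4 * net.gamma) * r ^ 2 - 3 * (Z t ω * r) := by
        field_simp; ring
      linarith
    have h5 : f (s t ω) = r ^ 2 := rfl
    rw [h5]
    linarith
  have i2 : ∀ t, Integrable (fun ω => Z t ω ^ 2) μ := fun t => (h.memLp_virtual hb hz₀ t 2).integrable_sq
  have i3 : ∀ t, Integrable (fun ω => Z t ω ^ 3) μ := fun t => by
    refine ((h.memLp_virtual hb hz₀ t (3 : ℕ)).integrable_norm_pow (by norm_num)).congr
      (.of_forall fun ω => ?_)
    simp only [Real.norm_of_nonneg (h.virtual_nonneg hz₀ t ω)]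
  have istep : ∀ t, ∫ ω, Z (t + 1) ω ^ 3 ∂μ + 2 * net.gamma * ∫ ω, Z t ω ^ 2 ∂μ ≤
      ∫ ω, Z t ω ^ 3 ∂μ + k := by
    intro t
    have if' : Integrable (fun ω => f (s t ω)) μ :=
      (hb.measurePreserving t).integrable_comp_of_integrable hfi
    have ifZ : Integrable (fun ω => Z t ω ^ 3 + 9 / (4 * net.gamma) * f (s t ω)) μ :=
      (i3 t).add (if'.const_mul _)
    have := integral_mono ((i3 (t + 1)).add ((i2 t).const_mul (2 * net.gamma)))
      (ifZ.add (integrable_const (b ^ 3)))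
      (step t)
    simp only [Pi.add_apply] at this
    rw [integral_add (i3 (t + 1)) ((i2 t).const_mul _), integral_add ifZ (integrable_const _), integral_add (i3 t) (if'.const_mul _),
      integral_const_mul, integral_const_mul, integral_const, hb.integral_comp hfm] at this
    simp only [probReal_univ, smul_eq_mul, one_mul] at this
    linarith
  have hsum : ∀ T : ℕ, ∫ ω, Z T ω ^ 3 ∂μ +
      2 * net.gamma * ∑ t ∈ Finset.range T, ∫ ω, Z t ω ^ 2 ∂μ ≤ z₀ ^ 3 + k * T := by
    intro T
    induction T with
    | zero => simp [h.virtual_zero]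
    | succ T ih =>
      rw [Finset.sum_range_succ]
      push_cast
      linarith [istep T]
  refine ⟨(z₀ ^ 3 + k) / (2 * net.gamma), fun T => ?_⟩
  have h3 : 0 ≤ ∫ ω, Z T ω ^ 3 ∂μ :=
    integral_nonneg fun ω => pow_nonneg (h.virtual_nonneg hz₀ T ω) 3
  have hz3 : 0 ≤ z₀ ^ 3 * T := by positivity
  have hk0 : 0 ≤ k := by positivity
  rw [div_mul_eq_mul_div, le_div_iff₀ (by positivity)]
  linarith [hsum T]

end IsControlled

end EdgeNetwork

namespace EdgeNetwork

variable {N : ℕ} {net : EdgeNetwork N} {Ω : Type*}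

/-! ### Utility of the average rates -/

/-- Jensen's inequality along a subsequence: the utility of the limsup of the average inputs
dominates any limit of lower bounds for the average utility of the inputs. -/
lemma le_sum_utility_averageRate {A : ℕ → Ω → Fin N → ℝ} {ω : Ω}
    (hA : ∀ t i, A t ω i ∈ Set.Icc 0 net.aMax) {T : ℕ → ℕ} (hT : Tendsto T atTop atTop)
    {e : ℕ → ℝ} {c : ℝ} (he : Tendsto e atTop (nhds c))
    (hle : ∀ k, 0 < T k →
      e k ≤ (∑ t ∈ Finset.Icc 1 (T k), ∑ i, net.utility i (A t ω i)) / T k) :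
    c ≤ ∑ i, net.utility i (averageRate A ω i) := by
  set u : Fin N → ℕ → ℝ := fun i n => (1 / (n : ℝ)) * ∑ t ∈ Finset.Icc 1 n, A t ω i with hu
  have hu0 : ∀ i n, 0 ≤ u i n := fun i n =>
    mul_nonneg (by positivity) (Finset.sum_nonneg fun t _ => (hA t i).1)
  have hu1 : ∀ i n, u i n ≤ net.aMax := by
    intro i n
    rcases Nat.eq_zero_or_pos n with rfl | hn
    · simpa [hu] using net.aMax_pos.le
    · have : ∑ t ∈ Finset.Icc 1 n, A t ω i ≤ n * net.aMax := by
        simpa using Finset.sum_le_card_nsmul (Finset.Icc 1 n) _ _ fun t _ => (hA t i).2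
      have hn' : (0 : ℝ) < n := by exact_mod_cast hn
      simp only [hu]
      rw [one_div_mul_eq_div, div_le_iff₀ hn']
      linarith
  have hbdd : ∀ i, IsBoundedUnder (· ≤ ·) atTop (u i) := fun i =>
    isBoundedUnder_of ⟨net.aMax, hu1 i⟩
  have hcobdd : ∀ i, IsCoboundedUnder (· ≤ ·) atTop (u i) := fun i =>
    (isBoundedUnder_of ⟨0, hu0 i⟩ : IsBoundedUnder (· ≥ ·) atTop (u i)).isCoboundedUnder_le
  have havg : ∀ i, averageRate A ω i = limsup (u i) atTop := fun i => rfl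
  have hlim0 : ∀ i, 0 ≤ averageRate A ω i := fun i => by
    rw [havg]
    exact le_limsup_of_frequently_le (.of_forall (hu0 i)) (hbdd i)
  have hjensen : ∀ i n, 0 < n →
      (∑ t ∈ Finset.Icc 1 n, net.utility i (A t ω i)) / n ≤ net.utility i (u i n) := by
    intro i n hn
    have hn' : (n : ℝ) ≠ 0 := by positivity
    have := (net.utility_concave i).le_map_sum (t := Finset.Icc 1 n) (w := fun _ => 1 / (n : ℝ))
      (p := fun t => A t ω i) (fun _ _ => by positivity) (by simp [hn']) fun t _ => (hA t i).1
    simp only [smul_eq_mul, ← Finset.mul_sum] at this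
    rwa [one_div_mul_eq_div] at this
  have hδ : ∀ δ : ℝ, 0 < δ → c ≤ ∑ i, net.utility i (averageRate A ω i + δ) := by
    intro δ hδ
    have hev : ∀ᶠ n in atTop, ∀ i, u i n < averageRate A ω i + δ :=
      eventually_all.2 fun i => eventually_lt_of_limsup_lt (by rw [← havg]; linarith) (hbdd i)
    refine le_of_tendsto he ?_
    filter_upwards [hT.eventually hev, hT.eventually_gt_atTop 0] with k hk hk0
    refine (hle k hk0).trans ?_
    rw [Finset.sum_comm, Finset.sum_div]
    exact Finset.sum_le_sum fun i _ => (hjensen i _ hk0).trans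
      (net.utility_mono i (hu0 i _) (add_nonneg (hlim0 i) hδ.le) (hk i).le)
  have hcont : Tendsto (fun δ : ℝ => ∑ i, net.utility i (averageRate A ω i + δ))
      (nhdsWithin 0 (Set.Ioi 0)) (nhds (∑ i, net.utility i (averageRate A ω i))) := by
    refine tendsto_finsetSum _ fun i _ => ?_
    have h1 := (net.utility_contDiff i).continuousOn (averageRate A ω i) (hlim0 i)
    refine Tendsto.comp h1 (tendsto_nhdsWithin_iff.2 ⟨?_, ?_⟩)
    · have : Tendsto (fun δ : ℝ => averageRate A ω i + δ) (nhds 0) (nhds (averageRate A ω i + 0)) :=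
        tendsto_const_nhds.add tendsto_id
      rw [add_zero] at this
      exact this.mono_left nhdsWithin_le_nhds
    · filter_upwards [self_mem_nhdsWithin] with δ hδ
      exact add_nonneg (hlim0 i) (le_of_lt hδ)
  exact ge_of_tendsto hcont (eventually_mem_nhdsWithin.mono hδ)

variable [mΩ : MeasurableSpace Ω] {μ : Measure Ω} {ℱ : Filtration ℕ mΩ}
  {s : ℕ → Ω → ChannelState N} {V : ℝ} {q₀ : Fin N → ℝ} {z₀ : ℝ}
  {Q A d : ℕ → Ω → Fin N → ℝ} {Z : ℕ → Ω → ℝ}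

/-- The one-slot drift bounds summed over `T` slots. -/
lemma IsControlled.sum_utility_ge (h : net.IsControlled ℱ V q₀ z₀ s Q A d Z)
    (hq₀ : ∀ i, 0 ≤ q₀ i) (hz₀ : 0 ≤ z₀) {p : ChannelState N → Fin N → ℝ}
    (hp : IsSchedulingPolicy p) (hpi : net.IsInterferenceAware p) {x : Fin N → ℝ}
    (hx : ∀ i, x i ∈ Set.Icc 0 net.aMax) (T : ℕ) (ω : Ω) :
    T * (2 * V * ∑ i, net.utility i (x i)
        - (N * net.aMax ^ 2 + net.gamma ^ 2 + max net.nu 0 ^ 2))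
      - (∑ i, q₀ i ^ 2 + z₀ ^ 2)
      - ∑ i, ∑ t ∈ Finset.range T, net.rate i (s t ω) ^ 2
      - 2 * (∑ i, ∑ t ∈ Finset.range T, Q t ω i * (x i - p (s t ω) i * net.rate i (s t ω))
        + ∑ t ∈ Finset.range T, Z t ω *
          (∑ i, net.power * interferenceGain (s t ω) i * p (s t ω) i - net.gamma)) ≤
    2 * V * ∑ t ∈ Finset.range T, ∑ i, net.utility i (A t ω i) := by
  have hsum := Finset.sum_le_sum fun t (_ : t ∈ Finset.range T) =>
    h.drift_le hq₀ hz₀ t ω hx (fun i => (hp.mem_Icc (s t ω) i).1) (hp.sum_le_one (s t ω))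
      (hpi.instantaneous (s t ω))
  rw [Finset.sum_sub_distrib, Finset.sum_range_sub (fun t => ∑ i, Q t ω i ^ 2 + Z t ω ^ 2)] at hsum
  simp only [Finset.sum_sub_distrib, Finset.sum_add_distrib, ← Finset.mul_sum,
    Finset.sum_const, Finset.card_range, nsmul_eq_mul, h.queue_zero, h.virtual_zero] at hsum
  have hL : 0 ≤ ∑ i, Q T ω i ^ 2 + Z T ω ^ 2 := by positivity
  rw [Finset.sum_comm (f := fun i t => net.rate i (s t ω) ^ 2),
    Finset.sum_comm (f := fun i t => Q t ω i * (x i - p (s t ω) i * net.rate i (s t ω)))]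
  linarith

lemma IsInterferenceAware.mul_le {p : ChannelState N → Fin N → ℝ}
    (hp : IsSchedulingPolicy p) (hpi : net.IsInterferenceAware p) (s : ChannelState N) (i : Fin N) :
    net.power * interferenceGain s i * p s i ≤ max net.nu 0 := by
  by_cases hlt : net.nu < net.power * interferenceGain s i
  · simp [hpi.instantaneous s i hlt]
  · exact (mul_le_of_le_one_right (interference_nonneg s i) (hp.mem_Icc s i).2).trans
      ((not_lt.1 hlt).trans (le_max_left _ _))

/-- Almost surely, the utility achieved by the controller is within `O(1 / V)` of that of any
feasible vector of arrival rates. -/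
lemma IsControlled.ae_utility_ge [IsProbabilityMeasure μ]
    (h : net.IsControlled ℱ V q₀ z₀ s Q A d Z) (hb : net.IsBlockFading μ ℱ s) (hV : 0 < V)
    (hq₀ : ∀ i, 0 ≤ q₀ i) (hz₀ : 0 ≤ z₀) {x : Fin N → ℝ} (hx : x ∈ net.stabilityRegion)
    (hxa : ∀ i, x i ≤ net.aMax) :
    ∀ᵐ ω ∂μ, ∑ i, net.utility i (x i)
      - ((N * net.aMax ^ 2 + net.gamma ^ 2 + max net.nu 0 ^ 2) + N * net.rMax ^ 2) / 2 / V ≤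
      ∑ i, net.utility i (averageRate A ω i) := by
  have := net.isProb
  obtain ⟨hx0, p, hp, hpi, hxp⟩ := hx
  -- the centred comparison services and interferences
  set ξ : Fin N → ChannelState N → ℝ := fun i y =>
    ∫ s, p s i * net.rate i s ∂net.law - p y i * net.rate i y with hξ
  set ζ : ChannelState N → ℝ := fun y => ∑ i, net.power * interferenceGain y i * p y i -
    ∑ i, ∫ s, net.power * interferenceGain s i * p s i ∂net.law with hζ
  have hpRm : ∀ i, Measurable fun y => p y i * net.rate i y := fun i =>
    (hp.measurable i).mul (net.rate_measurable i)
  have hpgm : ∀ i, Measurable fun y => net.power * interferenceGain y i * p y i := fun i =>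
    ((measurable_interferenceGain i).const_mul _).mul (hp.measurable i)
  have hpR : ∀ i, MemLp (fun y => p y i * net.rate i y) 2 net.law := fun i => by
    refine MemLp.of_le ((memLp_two_iff_integrable_sq
      (net.rate_measurable i).aestronglyMeasurable).2 (net.rate_sq_integrable i))
      (hpRm i).aestronglyMeasurable (.of_forall fun y => ?_)
    rw [Real.norm_of_nonneg (mul_nonneg (hp.mem_Icc y i).1 (net.rate_nonneg i y)),
      Real.norm_of_nonneg (net.rate_nonneg i y)]
    exact mul_le_of_le_one_left (net.rate_nonneg i y) (hp.mem_Icc y i).2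
  have hpg : ∀ i, MemLp (fun y => net.power * interferenceGain y i * p y i) 2 net.law := fun i => by
    refine MemLp.of_bound (hpgm i).aestronglyMeasurable (max net.nu 0) (.of_forall fun y => ?_)
    rw [Real.norm_of_nonneg (mul_nonneg (interference_nonneg y i) (hp.mem_Icc y i).1)]
    exact hpi.mul_le hp y i
  have hξm : ∀ i, Measurable (ξ i) := fun i => measurable_const.sub (hpRm i)
  have hζm : Measurable ζ := (Finset.measurable_fun_sum _ fun i _ => hpgm i).sub measurable_const
  have hξ2 : ∀ i, MemLp (ξ i) 2 net.law := fun i => (memLp_const _).sub (hpR i)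
  have hζ2 : MemLp ζ 2 net.law := (memLp_finsetSum _ fun i _ => hpg i).sub (memLp_const _)
  have hξ0 : ∀ i, ∫ y, ξ i y ∂net.law = 0 := fun i => by
    simp only [hξ]
    rw [integral_sub (integrable_const _) ((hpR i).integrable one_le_two)]
    simp
  have hζ0 : ∫ y, ζ y ∂net.law = 0 := by
    simp only [hζ]
    rw [integral_sub (integrable_finsetSum _ fun i _ => (hpg i).integrable one_le_two)
      (integrable_const _), integral_finsetSum _ fun i _ => (hpg i).integrable one_le_two]
    simp
  choose m hm0 hm using net.exists_utility_le
  have hQle := h.queue_le hV.le hq₀ hm0 hm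
  have hQ0 := h.queue_nonneg hq₀
  have hQ2 : ∀ i t, MemLp (fun ω => Q t ω i) 2 μ := fun i t => by
    refine MemLp.of_bound ((h.measurable_queue hb.measurable t i).mono
      (ℱ.le t) le_rfl).aestronglyMeasurable (q₀ i + V * m i + net.aMax) (.of_forall fun ω => ?_)
    rw [Real.norm_of_nonneg (hQ0 t ω i)]
    exact hQle t ω i
  have hQK : ∀ i, ∀ T : ℕ, ∑ t ∈ Finset.range T, ∫ ω, Q t ω i ^ 2 ∂μ ≤
      (q₀ i + V * m i + net.aMax) ^ 2 * (T + 1) := fun i T => by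
    have hone : ∀ t, ∫ ω, Q t ω i ^ 2 ∂μ ≤ (q₀ i + V * m i + net.aMax) ^ 2 := fun t => by
      refine (integral_mono (hQ2 i t).integrable_sq
        (integrable_const ((q₀ i + V * m i + net.aMax) ^ 2)) fun ω =>
          pow_le_pow_left₀ (hQ0 t ω i) (hQle t ω i) 2).trans ?_
      simp
    have := Finset.sum_le_card_nsmul (Finset.range T) _ _ fun t _ => hone t
    rw [Finset.card_range, nsmul_eq_mul] at this
    nlinarith [sq_nonneg (q₀ i + V * m i + net.aMax)]
  obtain ⟨K, hK⟩ := h.exists_sum_integral_virtual_sq_le hb hq₀ hz₀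
    (c := ∑ i, (q₀ i + V * m i + net.aMax)) fun t ω i => (hQle t ω i).trans
      (Finset.single_le_sum (f := fun i => q₀ i + V * m i + net.aMax)
        (fun j _ => (hQ0 t ω j).trans (hQle t ω j)) (Finset.mem_univ i))
  have hSQ : ∀ᵐ ω ∂μ, ∀ i, Tendsto (fun k : ℕ =>
      (∑ t ∈ Finset.range ((k + 1) ^ 2), Q t ω i * ξ i (s t ω)) / ((k + 1) ^ 2 : ℕ))
      atTop (nhds 0) := ae_all_iff.2 fun i =>
    hb.ae_tendsto_weighted_average (hξm i) (hξ2 i) (hξ0 i)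
      (fun t => h.measurable_queue hb.measurable t i) (hQ2 i) (hQK i)
  have hSZ := hb.ae_tendsto_weighted_average hζm hζ2 hζ0 (h.measurable_virtual hb.measurable)
    (fun t => h.memLp_virtual hb hz₀ t 2) hK
  have hSR : ∀ᵐ ω ∂μ, ∀ i, Tendsto (fun n : ℕ =>
      (∑ t ∈ Finset.range n, net.rate i (s t ω) ^ 2) / n) atTop
      (nhds (∫ y, net.rate i y ^ 2 ∂net.law)) := ae_all_iff.2 fun i =>
    hb.ae_tendsto_average ((net.rate_measurable i).pow_const 2) (net.rate_sq_integrable i)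
  have hT : Tendsto (fun k : ℕ => (k + 1) ^ 2) atTop atTop :=
    (tendsto_pow_atTop two_ne_zero).comp (tendsto_add_atTop_nat 1)
  have hTinv : ∀ a : ℝ, Tendsto (fun k : ℕ => a / (((k + 1) ^ 2 : ℕ) : ℝ)) atTop (nhds 0) :=
    fun a => tendsto_const_nhds.div_atTop (tendsto_natCast_atTop_atTop.comp hT)
  filter_upwards [hSQ, hSZ, hSR] with ω hQω hZω hRω
  set b := N * net.aMax ^ 2 + net.gamma ^ 2 + max net.nu 0 ^ 2 with hbdef
  set u := ∑ i, net.utility i (x i)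
  set w := ∑ i, net.utility i net.aMax
  have hlim : Tendsto (fun k : ℕ => u - (b
      + (∑ i, q₀ i ^ 2 + z₀ ^ 2) / (((k + 1) ^ 2 : ℕ) : ℝ)
      + ∑ i, (∑ t ∈ Finset.range ((k + 1) ^ 2), net.rate i (s t ω) ^ 2) / (((k + 1) ^ 2 : ℕ) : ℝ)
      + 2 * (∑ i, (∑ t ∈ Finset.range ((k + 1) ^ 2), Q t ω i * ξ i (s t ω)) /
          (((k + 1) ^ 2 : ℕ) : ℝ)
        + (∑ t ∈ Finset.range ((k + 1) ^ 2), Z t ω * ζ (s t ω)) / (((k + 1) ^ 2 : ℕ) : ℝ)))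
      / (2 * V) - w / (((k + 1) ^ 2 : ℕ) : ℝ)) atTop
      (nhds (u - (b + 0 + ∑ i, ∫ y, net.rate i y ^ 2 ∂net.law
        + 2 * (∑ _i : Fin N, 0 + 0)) / (2 * V) - 0)) := by
    refine ((Tendsto.div_const (((tendsto_const_nhds.add (hTinv _)).add
      (tendsto_finsetSum _ fun i _ => (hRω i).comp hT)).add
      (((tendsto_finsetSum _ fun i _ => hQω i).add hZω).const_mul 2)) _).const_sub u).sub
      (hTinv w)
  refine le_trans ?_ (le_sum_utility_averageRate (fun t i => (h.flow t ω i).1) hT hlim ?_)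
  · have hr : ∑ i, ∫ y, net.rate i y ^ 2 ∂net.law ≤ N * net.rMax ^ 2 := by
      simpa using Finset.sum_le_card_nsmul Finset.univ _ _ fun i _ => net.rate_sq_le i
    rw [div_div, sub_zero]
    refine sub_le_sub_left (div_le_div_of_nonneg_right ?_ (by positivity)) _
    simpa using hr
  · intro k hk
    set T := (k + 1) ^ 2
    have hT0 : (0 : ℝ) < (T : ℕ) := by exact_mod_cast hk
    have hmain := h.sum_utility_ge hq₀ hz₀ hp hpi (fun i => ⟨hx0 i, hxa i⟩) T ω
    rw [← hbdef] at hmain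
    have hQc : ∑ i, ∑ t ∈ Finset.range T, Q t ω i * (x i - p (s t ω) i * net.rate i (s t ω)) ≤
        ∑ i, ∑ t ∈ Finset.range T, Q t ω i * ξ i (s t ω) :=
      Finset.sum_le_sum fun i _ => Finset.sum_le_sum fun t _ =>
        mul_le_mul_of_nonneg_left (sub_le_sub_right (hxp i) _) (hQ0 t ω i)
    have hZc : ∑ t ∈ Finset.range T, Z t ω *
        (∑ i, net.power * interferenceGain (s t ω) i * p (s t ω) i - net.gamma) ≤
        ∑ t ∈ Finset.range T, Z t ω * ζ (s t ω) :=
      Finset.sum_le_sum fun t _ =>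
        mul_le_mul_of_nonneg_left (sub_le_sub_left hpi.average_le _) (h.virtual_nonneg hz₀ t ω)
    -- the averages start at slot `1`, the drift at slot `0`
    have hshift : ∑ t ∈ Finset.range T, ∑ i, net.utility i (A t ω i) ≤
        w + ∑ t ∈ Finset.Icc 1 T, ∑ i, net.utility i (A t ω i) := by
      have hU0 : ∀ t, 0 ≤ ∑ i, net.utility i (A t ω i) := fun t =>
        Finset.sum_nonneg fun i _ => net.utility_nonneg i (h.flow t ω i).1.1
      have hUw : ∑ i, net.utility i (A 0 ω i) ≤ w := Finset.sum_le_sum fun i _ =>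
        net.utility_mono i (h.flow 0 ω i).1.1 net.aMax_pos.le (h.flow 0 ω i).1.2
      have hsub : Finset.range T ⊆ insert 0 (Finset.Icc 1 T) := fun t ht => by
        simp only [Finset.mem_range, Finset.mem_insert, Finset.mem_Icc] at ht ⊢
        omega
      refine (Finset.sum_le_sum_of_subset_of_nonneg hsub fun t _ _ => hU0 t).trans ?_
      rw [Finset.sum_insert (by simp)]
      linarith
    rw [le_div_iff₀ hT0]
    simp only [← Finset.sum_div]
    have h2V : 0 < 2 * V := by positivity
    have hmul := mul_le_mul_of_nonneg_left hshift h2V.le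
    rw [← mul_le_mul_iff_right₀ h2V]
    refine le_trans (le_of_eq ?_) (by linarith :
      T * (2 * V * u - b) - (∑ i, q₀ i ^ 2 + z₀ ^ 2)
        - ∑ i, ∑ t ∈ Finset.range T, net.rate i (s t ω) ^ 2
        - 2 * (∑ i, ∑ t ∈ Finset.range T, Q t ω i * ξ i (s t ω)
          + ∑ t ∈ Finset.range T, Z t ω * ζ (s t ω)) - 2 * V * w ≤ _)
    field_simp
    ring

lemma zero_mem_stabilityRegion : (0 : Fin N → ℝ) ∈ net.stabilityRegion :=
  ⟨fun _ => le_rfl, fun _ _ => 0, ⟨fun _ => measurable_const, fun _ _ => by simp, fun _ => by simp⟩,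
    ⟨by simpa using net.gamma_pos.le, fun _ _ _ => rfl⟩, fun _ => by simp⟩

/-- The supremum defining `U*` is approached by countably many feasible rate vectors, so the
almost sure comparison with each of them passes to `U*`. -/
lemma IsControlled.ae_optimalUtility_le [IsProbabilityMeasure μ]
    (h : net.IsControlled ℱ V q₀ z₀ s Q A d Z) (hb : net.IsBlockFading μ ℱ s) (hV : 0 < V)
    (hq₀ : ∀ i, 0 ≤ q₀ i) (hz₀ : 0 ≤ z₀) :
    ∀ᵐ ω ∂μ, net.optimalUtility
      - ((N * net.aMax ^ 2 + net.gamma ^ 2 + max net.nu 0 ^ 2) + N * net.rMax ^ 2) / 2 / V ≤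
      ∑ i, net.utility i (averageRate A ω i) := by
  have hne : ((fun x : Fin N → ℝ => ∑ i, net.utility i (x i)) ''
      {x | x ∈ net.stabilityRegion ∧ ∀ i, x i ≤ net.aMax}).Nonempty :=
    ⟨_, 0, ⟨zero_mem_stabilityRegion, fun _ => net.aMax_pos.le⟩, rfl⟩
  have hx : ∀ n : ℕ, ∃ x : Fin N → ℝ, (x ∈ net.stabilityRegion ∧ ∀ i, x i ≤ net.aMax) ∧
      net.optimalUtility - 1 / ((n : ℝ) + 1) < ∑ i, net.utility i (x i) := fun n => by
    obtain ⟨_, ⟨x, hx, rfl⟩, hlt⟩ := exists_lt_of_lt_csSup hne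
      (sub_lt_self net.optimalUtility (Nat.one_div_pos_of_nat (n := n)))
    exact ⟨x, hx, hlt⟩
  choose x hx hxlt using hx
  filter_upwards [ae_all_iff.2 fun n =>
    h.ae_utility_ge hb hV hq₀ hz₀ (hx n).1 (hx n).2] with ω hω
  have hlim : Tendsto (fun n : ℕ => net.optimalUtility - 1 / ((n : ℝ) + 1)) atTop
      (nhds (net.optimalUtility - 0)) := tendsto_one_div_add_atTop_nhds_zero_nat.const_sub _
  rw [sub_zero] at hlim
  refine le_of_tendsto (hlim.sub_const _) (.of_forall fun n => ?_)
  linarith [hω n, hxlt n]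

/-- The sure bound on the backlogs bounds their long-term average. -/
lemma IsControlled.averageBacklog_le [IsProbabilityMeasure μ]
    (h : net.IsControlled ℱ V q₀ z₀ s Q A d Z) (hV : 0 ≤ V) (hq₀ : ∀ i, 0 ≤ q₀ i)
    {m : Fin N → ℝ} (hm0 : ∀ i, 0 ≤ m i)
    (hm : ∀ i, ∀ x ∈ Set.Icc 0 net.aMax, net.utility i x ≤ m i * x) :
    averageBacklog μ Q ≤ ENNReal.ofReal (∑ i, (q₀ i + V * m i + net.aMax)) := by
  have ha := net.aMax_pos
  have hle : ∀ t, ∑ i, ∫⁻ ω, ENNReal.ofReal (Q t ω i) ∂μ ≤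
      ENNReal.ofReal (∑ i, (q₀ i + V * m i + net.aMax)) := fun t => by
    rw [ENNReal.ofReal_sum_of_nonneg fun i _ =>
      by have := hq₀ i; have := hm0 i; positivity]
    refine Finset.sum_le_sum fun i _ => ?_
    refine (lintegral_mono fun ω =>
      ENNReal.ofReal_le_ofReal (h.queue_le hV hq₀ hm0 hm t ω i)).trans ?_
    simp
  refine limsup_le_of_le (h := .of_forall fun T => ?_)
  refine ENNReal.div_le_of_le_mul ?_
  rw [mul_comm]
  simpa using Finset.sum_le_card_nsmul (Finset.range T) _ _ fun t _ => hle t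

end EdgeNetwork

end EdgeControl

theorem theorem3 {N : ℕ} (net : EdgeControl.EdgeNetwork N)
    (q₀ : Fin N → ℝ) (hq₀ : ∀ i, 0 ≤ q₀ i) (z₀ : ℝ) (hz₀ : 0 ≤ z₀) :
    ∃ B₁ ε₁ κ : ℝ, 0 < B₁ ∧ 0 < ε₁ ∧ 0 < κ ∧
      ∀ V : ℝ, 0 < V →
      ∀ (Ω : Type*) [mΩ : MeasurableSpace Ω] (μ : Measure Ω) [IsProbabilityMeasure μ]
        (ℱ : Filtration ℕ mΩ) (s : ℕ → Ω → EdgeControl.ChannelState N)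
        (Q A d : ℕ → Ω → Fin N → ℝ) (Z : ℕ → Ω → ℝ),
        net.IsBlockFading μ ℱ s →
        net.IsControlled ℱ V q₀ z₀ s Q A d Z →
          (∀ᵐ ω ∂μ, net.optimalUtility - B₁ / V ≤
            ∑ i, net.utility i (EdgeControl.averageRate A ω i)) ∧
          EdgeControl.averageBacklog μ Q ≤ ENNReal.ofReal ((B₁ + V * κ) / ε₁) := by
  choose m hm0 hm using net.exists_utility_le
  set b := ((N * net.aMax ^ 2 + net.gamma ^ 2 + max net.nu 0 ^ 2) + N * net.rMax ^ 2) / 2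
  have hγ := net.gamma_pos
  have ha := net.aMax_pos
  have hb0 : 0 < b := by positivity
  have hqa : 0 ≤ ∑ i, (q₀ i + net.aMax) :=
    Finset.sum_nonneg fun i _ => add_nonneg (hq₀ i) ha.le
  have hm1 : 0 ≤ ∑ i, m i := Finset.sum_nonneg fun i _ => hm0 i
  -- the sure bound on the backlogs is linear in `V`, so no slack parameter is needed: `ε₁ = 1`
  refine ⟨b + ∑ i, (q₀ i + net.aMax), 1, ∑ i, m i + 1, by positivity, one_pos, by positivity, ?_⟩
  intro V hV Ω mΩ μ _ ℱ s Q A d Z hfad hctl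
  constructor
  · filter_upwards [hctl.ae_optimalUtility_le hfad hV hq₀ hz₀] with ω hω
    refine le_trans (sub_le_sub_left ?_ _) hω
    exact div_le_div_of_nonneg_right (le_add_of_nonneg_right hqa) hV.le
  · refine (hctl.averageBacklog_le hV.le hq₀ hm0 hm).trans (ENNReal.ofReal_le_ofReal ?_)
    have e : ∑ i, (q₀ i + V * m i + net.aMax) = ∑ i, (q₀ i + net.aMax) + V * ∑ i, m i := by
      rw [Finset.mul_sum, ← Finset.sum_add_distrib]
      exact Finset.sum_congr rfl fun i _ => by ring
    rw [e, div_one]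
    linarith
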